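/- Let $S=\mathbb{R}^4$ with coordinates $(x,y,z,a)$ be the four-dimensional Damek–Ricci group with group law $$(v,z,a)\cdot(v',z',a')=\bigl(v+e^{a/2}v',\ z+e^{a}z'+\tfrac12 e^{a/2}[v,v'],\ a+a'\bigr),\qquad v=(x,y),\ v'=(x',y'),\ [v,v']=xy'-yx',$$ and let $g$ be the left-invariant Riemannian metric on $S$ for which the left-invariant vector fields $$V=e^{a/2}\Bigl(\partial_x-\tfrac y2\,\partial_z\Bigr),\quad J_ZV=e^{a/2}\Bigl(\partial_y+\tfrac x2\,\partial_z\Bigr),\quad Z=e^{a}\,\partial_z,\quad A=\partial_a$$ are orthonormal; $(S,g)$ is the complex hyperbolic plane $\mathbb{C}H^2$ (of holomorphic sectional curvature $-1$). Let $\xi$ be a smooth conformal vector field on $(S,g)$ with smooth potential function $\rho$, that is, $\mathcal{L}_\xi g=2\rho g$, and write $\xi=f_1V+f_2\,J_ZV+f_3Z+f_4A$. Then $f_4$ does not depend on the variable $a$, $\rho=\partial f_4/\partial a$, and hence $\rho=0$ everywhere; that is, $\xi$ is a Killing vector field: $\mathcal{L}_\xi g=0$. -/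

import Mathlib

/-! The complex hyperbolic plane as a Damek–Ricci space. -/

namespace CH2

/-- The underlying manifold of the solvable group `S = N ⋊ ℝA`, with its global coordinates
`(x, y, z, a) = (p 0, p 1, p 2, p 3)`; the tangent space at each point is identified with `Space`
through these coordinates, and the Lie algebra is the tangent space at the identity `0`,
with basis `V, J_Z V, Z, A` the coordinate vectors `0, 1, 2, 3`. -/
abbrev Space : Type := Fin 4 → ℝ

/-- The `Z`-component of the bracket of the `𝔳`-parts, `𝔳 = span {V, J_Z V}`, `[V, J_Z V] = Z`. -/
def bracketZ (p q : Space) : ℝ := p 0 * q 1 - p 1 * q 0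

/-- The group law
`(v, z, a) (v', z', a') = (v + e^{a/2} v', z + e^a z' + (1/2) e^{a/2} [v, v'], a + a')`. -/
noncomputable def mul (p q : Space) : Space :=
  ![p 0 + Real.exp (p 3 / 2) * q 0,
    p 1 + Real.exp (p 3 / 2) * q 1,
    p 2 + Real.exp (p 3) * q 2 + 1 / 2 * Real.exp (p 3 / 2) * bracketZ p q,
    p 3 + q 3]

/-- The inverse in the group. -/
noncomputable def inv (p : Space) : Space :=
  ![-(Real.exp (-(p 3) / 2) * p 0), -(Real.exp (-(p 3) / 2) * p 1),
    -(Real.exp (-(p 3)) * p 2), -(p 3)]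

theorem mul_assoc' (p q r : Space) : mul (mul p q) r = mul p (mul q r) := by
  have h : Real.exp ((p 3 + q 3) / 2) = Real.exp (p 3 / 2) * Real.exp (q 3 / 2) := by
    rw [← Real.exp_add]; ring_nf
  have h2 : Real.exp (p 3) = Real.exp (p 3 / 2) * Real.exp (p 3 / 2) := by
    rw [← Real.exp_add]; ring_nf
  ext i
  fin_cases i <;> simp [mul, bracketZ, h, Real.exp_add] <;> (try rw [h2]) <;> ring

theorem zero_mul' (p : Space) : mul 0 p = p := by
  ext i; fin_cases i <;> simp [mul, bracketZ]

theorem mul_zero' (p : Space) : mul p 0 = p := by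
  ext i; fin_cases i <;> simp [mul, bracketZ]

theorem inv_mul' (p : Space) : mul (inv p) p = 0 := by
  ext i; fin_cases i <;> simp [mul, inv, bracketZ]
  ring

/-- The left-invariant vector field whose value at the identity is `u`: at `p` it is the
differential at the identity of the left translation by `p`, applied to `u`. -/
noncomputable def leftInvariant (u : Space) (p : Space) : Space := fderiv ℝ (mul p) 0 u

/-- The left-invariant vector fields `V`, `J_Z V`, `Z`, `A` (indices `0, 1, 2, 3`). -/
noncomputable def frame (i : Fin 4) : Space → Space := leftInvariant (Pi.single i 1)

/-- The differential at `p` of the left translation by `p⁻¹`: it identifies the tangent space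
at `p` with the Lie algebra. -/
noncomputable def toLieAlgebra (p : Space) : Space →L[ℝ] Space := fderiv ℝ (mul (inv p)) p

/-- The left-invariant Riemannian metric for which `V, J_Z V, Z, A` are orthonormal at the
identity. -/
noncomputable def metric (p u v : Space) : ℝ := ∑ i, toLieAlgebra p u i * toLieAlgebra p v i

/-- The component of a vector field `ξ` along the `i`-th vector field of the orthonormal frame
`V, J_Z V, Z, A`; the component along `A` is the one with index `3`. -/
noncomputable def component (ξ : Space → Space) (i : Fin 4) (p : Space) : ℝ :=
  metric p (ξ p) (frame i p)

/-- The Lie derivative of the metric,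
`(L_ξ g)(X, Y) = ξ (g(X, Y)) - g([ξ, X], Y) - g(X, [ξ, Y])`, at the point `p`. -/
noncomputable def lieDerivMetric (ξ X Y : Space → Space) (p : Space) : ℝ :=
  fderiv ℝ (fun q => metric q (X q) (Y q)) p (ξ p)
    - metric p (VectorField.lieBracket ℝ ξ X p) (Y p)
    - metric p (X p) (VectorField.lieBracket ℝ ξ Y p)

/-- `ξ` is a (smooth) conformal vector field with (smooth) potential function `ρ`:
`L_ξ g = 2 ρ g`. -/
def IsConformalWithPotential (ξ : Space → Space) (ρ : Space → ℝ) : Prop :=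
  ContDiff ℝ (⊤ : ℕ∞) ξ ∧ ContDiff ℝ (⊤ : ℕ∞) ρ ∧
    ∀ X Y : Space → Space, ContDiff ℝ (⊤ : ℕ∞) X → ContDiff ℝ (⊤ : ℕ∞) Y →
      ∀ p, lieDerivMetric ξ X Y p = 2 * ρ p * metric p (X p) (Y p)

/-- `ξ` is a (smooth) Killing vector field: `L_ξ g = 0`. -/
def IsKilling (ξ : Space → Space) : Prop :=
  ContDiff ℝ (⊤ : ℕ∞) ξ ∧
    ∀ X Y : Space → Space, ContDiff ℝ (⊤ : ℕ∞) X → ContDiff ℝ (⊤ : ℕ∞) Y →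
      ∀ p, lieDerivMetric ξ X Y p = 0

/-- Left translations are affine in coordinates; this is their differential. -/
theorem fderiv_mul (p q u : Space) :
    fderiv ℝ (mul p) q u =
      ![Real.exp (p 3 / 2) * u 0, Real.exp (p 3 / 2) * u 1,
        Real.exp (p 3) * u 2 + 1 / 2 * Real.exp (p 3 / 2) * bracketZ p u, u 3] := by
  let L : Space →ₗ[ℝ] Space :=
    { toFun := fun u => ![Real.exp (p 3 / 2) * u 0, Real.exp (p 3 / 2) * u 1,
        Real.exp (p 3) * u 2 + 1 / 2 * Real.exp (p 3 / 2) * bracketZ p u, u 3]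
      map_add' := by
        intro u v; ext i; fin_cases i <;> simp [bracketZ] <;> ring
      map_smul' := by
        intro c u; ext i; fin_cases i <;> simp [bracketZ] <;> ring }
  have hL : mul p = fun q => p + LinearMap.toContinuousLinearMap L q := by
    funext q; ext i; fin_cases i <;> simp [mul, L] <;> ring
  rw [hL, fderiv_const_add, ContinuousLinearMap.fderiv]
  rfl

/-- The left-invariant vector fields in coordinates:
`V = e^{a/2} (∂_x - (y/2) ∂_z)`, `J_Z V = e^{a/2} (∂_y + (x/2) ∂_z)`, `Z = e^a ∂_z`, `A = ∂_a`. -/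
theorem frame_eq (p : Space) :
    frame 0 p = ![Real.exp (p 3 / 2), 0, -(Real.exp (p 3 / 2) * (p 1 / 2)), 0] ∧
    frame 1 p = ![0, Real.exp (p 3 / 2), Real.exp (p 3 / 2) * (p 0 / 2), 0] ∧
    frame 2 p = ![0, 0, Real.exp (p 3), 0] ∧
    frame 3 p = ![0, 0, 0, 1] := by
  refine ⟨?_, ?_, ?_, ?_⟩ <;> ext i <;> fin_cases i <;>
    simp [frame, leftInvariant, fderiv_mul, bracketZ] <;> ring

/-- The identification of the tangent space at `p` with the Lie algebra, in coordinates. -/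
theorem toLieAlgebra_apply (p u : Space) :
    toLieAlgebra p u =
      ![Real.exp (-(p 3) / 2) * u 0, Real.exp (-(p 3) / 2) * u 1,
        Real.exp (-(p 3)) * (u 2 + p 1 / 2 * u 0 - p 0 / 2 * u 1), u 3] := by
  have h2 : Real.exp (-(p 3)) = Real.exp (-(p 3) / 2) * Real.exp (-(p 3) / 2) := by
    rw [← Real.exp_add]; ring_nf
  ext i
  fin_cases i <;> simp [toLieAlgebra, fderiv_mul, inv, bracketZ]
  rw [h2]
  ring

/-- Every vector field is `ξ = f₁ V + f₂ J_Z V + f₃ Z + f₄ A` with its components `fᵢ`. -/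
theorem eq_sum_component (ξ : Space → Space) (p : Space) :
    ξ p = ∑ i, component ξ i p • frame i p := by
  obtain ⟨h0, h1, h2, h3⟩ := frame_eq p
  have e1 : Real.exp (-(p 3) / 2) * Real.exp (p 3 / 2) = 1 := by
    rw [← Real.exp_add]; ring_nf; exact Real.exp_zero
  have e2 : Real.exp (-(p 3)) * Real.exp (p 3) = 1 := by
    rw [← Real.exp_add]; ring_nf; exact Real.exp_zero
  simp only [component, metric, Fin.sum_univ_four, h0, h1, h2, h3, toLieAlgebra_apply]
  ext i
  fin_cases i <;> simp <;> grind

end CH2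

namespace CH2

/-! A conformal field preserves the (1,3) Weyl tensor W, while |W|² scales with weight governed by
ρ. The complex hyperbolic plane is homogeneous and not conformally flat, so |W|² is a nonzero
constant, which forces ρ = 0. The proof extracts this from one curvature component. In the
left-invariant frame, L_ξ g = 2ρg is a first-order linear system for the components of ξ with
constant coefficients (`lieDerivMetric_leftInvariant`), and the frame derivatives commute up to the
Lie algebra bracket (`derivAlong_comm`). The (A, A) equation says ρ = A f₄. Differentiating the
others twice and eliminating leaves A f₄ = 0 (`eq_zero_of_conformal_system`). As A = ∂_a, f₄ is then
constant in a. -/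

theorem leftInvariant_apply (u p : Space) :
    leftInvariant u p =
      ![Real.exp (p 3 / 2) * u 0, Real.exp (p 3 / 2) * u 1,
        Real.exp (p 3) * u 2 + 1 / 2 * Real.exp (p 3 / 2) * bracketZ p u, u 3] :=
  fderiv_mul p 0 u

theorem contDiff_leftInvariant (u : Space) : ContDiff ℝ (⊤ : ℕ∞) (leftInvariant u) := by
  rw [funext (leftInvariant_apply u), contDiff_pi]
  intro i
  fin_cases i <;> simp [bracketZ] <;> fun_prop

theorem differentiable_leftInvariant (u : Space) : Differentiable ℝ (leftInvariant u) :=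
  (contDiff_leftInvariant u).differentiable (by simp)

theorem fderiv_leftInvariant (u p v : Space) :
    fderiv ℝ (leftInvariant u) p v =
      ![Real.exp (p 3 / 2) * (v 3 / 2) * u 0, Real.exp (p 3 / 2) * (v 3 / 2) * u 1,
        Real.exp (p 3) * v 3 * u 2 + 1 / 2 * (Real.exp (p 3 / 2) * (v 3 / 2) * bracketZ p u
          + Real.exp (p 3 / 2) * bracketZ v u), 0] := by
  -- Restricting to the line t ↦ p + t v reduces the computation to one-variable derivatives,
  -- coordinate by coordinate.
  have hv (i : Fin 4) : HasDerivAt (fun t : ℝ => p i + t * v i) (v i) 0 := by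
    simpa using ((hasDerivAt_id (0 : ℝ)).mul_const (v i)).const_add (p i)
  have hline : HasDerivAt (fun t : ℝ => p + t • v) v 0 := by
    rw [hasDerivAt_pi]
    exact hv
  have h := (differentiable_leftInvariant u (p + (0 : ℝ) • v)).hasFDerivAt.comp_hasDerivAt 0 hline
  rw [zero_smul, add_zero] at h
  refine h.unique ?_
  have e1 := ((hv 3).div_const 2).exp
  have e2 := (hv 3).exp
  have e3 := ((hv 0).mul_const (u 1)).sub ((hv 1).mul_const (u 0))
  simp only [zero_mul, add_zero] at e1 e2 e3
  rw [hasDerivAt_pi]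
  intro i
  fin_cases i
  · simpa [Function.comp_def, leftInvariant_apply] using e1.mul_const (u 0)
  · simpa [Function.comp_def, leftInvariant_apply] using e1.mul_const (u 1)
  · have := (e2.mul_const (u 2)).add ((e1.mul e3).const_mul (1 / 2))
    simpa [Function.comp_def, leftInvariant_apply, bracketZ, mul_assoc, Pi.add_def] using this
  · simpa [Function.comp_def, leftInvariant_apply] using hasDerivAt_const (0 : ℝ) (u 3)

/-- The bracket of the Lie algebra of the group. -/
noncomputable def lieAlgebraBracket (u w : Space) : Space :=
  ![(u 3 * w 0 - u 0 * w 3) / 2, (u 3 * w 1 - u 1 * w 3) / 2,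
    u 3 * w 2 - u 2 * w 3 + bracketZ u w, 0]

theorem lieBracket_leftInvariant (u w p : Space) :
    VectorField.lieBracket ℝ (leftInvariant u) (leftInvariant w) p =
      leftInvariant (lieAlgebraBracket u w) p := by
  have h2 : Real.exp (p 3) = Real.exp (p 3 / 2) * Real.exp (p 3 / 2) := by
    rw [← Real.exp_add]; ring_nf
  simp only [VectorField.lieBracket, fderiv_leftInvariant]
  simp only [leftInvariant_apply]
  ext i
  fin_cases i <;> simp [bracketZ, lieAlgebraBracket] <;> (try rw [h2]) <;> ring

theorem toLieAlgebra_leftInvariant (u p : Space) :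
    toLieAlgebra p (leftInvariant u p) = u := by
  have e1 : Real.exp (-(p 3) / 2) * Real.exp (p 3 / 2) = 1 := by
    rw [← Real.exp_add]; ring_nf; exact Real.exp_zero
  have e2 : Real.exp (-(p 3)) * Real.exp (p 3) = 1 := by
    rw [← Real.exp_add]; ring_nf; exact Real.exp_zero
  rw [toLieAlgebra_apply, leftInvariant_apply]
  ext i
  fin_cases i <;> simp [bracketZ] <;> grind

theorem metric_leftInvariant (u w p : Space) :
    metric p (leftInvariant u p) (leftInvariant w p) = ∑ i, u i * w i := by
  simp only [metric, toLieAlgebra_leftInvariant]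

theorem component_eq (ξ : Space → Space) (i : Fin 4) (p : Space) :
    component ξ i p = toLieAlgebra p (ξ p) i := by
  simp [component, metric, frame, toLieAlgebra_leftInvariant, Pi.single_apply]

/-! ### Frame derivatives as operators on smooth functions -/

/-- The real vector space of smooth functions on the group. -/
def smoothFunctions : Submodule ℝ (Space → ℝ) where
  carrier := {f | ContDiff ℝ (⊤ : ℕ∞) f}
  add_mem' hf hg := Set.mem_ofPred.2 ((Set.mem_ofPred.1 hf).add (Set.mem_ofPred.1 hg))
  zero_mem' := Set.mem_ofPred.2 contDiff_const
  smul_mem' c _ hf := Set.mem_ofPred.2 ((Set.mem_ofPred.1 hf).const_smul c)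

theorem smoothFunctions_contDiff (f : smoothFunctions) : ContDiff ℝ (⊤ : ℕ∞) f.1 := f.2

theorem smoothFunctions_differentiable (f : smoothFunctions) : Differentiable ℝ f.1 :=
  (smoothFunctions_contDiff f).differentiable (by simp)

/-- The derivative of smooth functions along the left-invariant vector field with value `u` at the
identity. -/
noncomputable def derivAlong (u : Space) : smoothFunctions →ₗ[ℝ] smoothFunctions where
  toFun f := ⟨fun p => fderiv ℝ f.1 p (leftInvariant u p),
    ((smoothFunctions_contDiff f).fderiv_right (by simp)).clm_apply (contDiff_leftInvariant u)⟩
  map_add' f g := by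
    ext p
    simp [fderiv_add (smoothFunctions_differentiable f p) (smoothFunctions_differentiable g p)]
  map_smul' c f := by
    ext p
    simp [fderiv_const_smul (smoothFunctions_differentiable f p)]

theorem derivAlong_apply (u : Space) (f : smoothFunctions) (p : Space) :
    (derivAlong u f).1 p = fderiv ℝ f.1 p (leftInvariant u p) := rfl

/-- Symmetry of second derivatives, together with the bracket of left-invariant fields being
left-invariant. -/
theorem derivAlong_comm (u w : Space) (f : smoothFunctions) :
    derivAlong u (derivAlong w f) =
      derivAlong w (derivAlong u f) + derivAlong (lieAlgebraBracket u w) f := by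
  ext p
  have h := VectorField.fderiv_apply_lieBracket (𝕜 := ℝ) (x := p) (f := f.1)
    (smoothFunctions_contDiff f).contDiffAt (by simpa using WithTop.coe_le_coe.2 (le_top : (2 : ℕ∞) ≤ ⊤))
    (differentiable_leftInvariant w p) (differentiable_leftInvariant u p)
  rw [lieBracket_leftInvariant] at h
  simp only [Submodule.coe_add, Pi.add_apply, derivAlong_apply] at h ⊢
  change fderiv ℝ (fun q => fderiv ℝ f.1 q (leftInvariant w q)) p (leftInvariant u p) =
    fderiv ℝ (fun q => fderiv ℝ f.1 q (leftInvariant u q)) p (leftInvariant w p) + _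
  linarith

theorem leftInvariant_smul (c : ℝ) (u : Space) (p : Space) :
    leftInvariant (c • u) p = c • leftInvariant u p := map_smul _ _ _

theorem derivAlong_smul (c : ℝ) (u : Space) (f : smoothFunctions) :
    derivAlong (c • u) f = c • derivAlong u f := by
  ext p
  simp [derivAlong_apply, leftInvariant_smul]

/-! ### The conformal equations in the frame -/

theorem contDiff_component {ξ : Space → Space} (hξ : ContDiff ℝ (⊤ : ℕ∞) ξ) (i : Fin 4) :
    ContDiff ℝ (⊤ : ℕ∞) (component ξ i) := by
  have h (i : Fin 4) : ContDiff ℝ (⊤ : ℕ∞) fun p => ξ p i := contDiff_pi.1 hξ i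
  have h0 := h 0
  have h1 := h 1
  have h2 := h 2
  have h3 := h 3
  rw [funext (component_eq ξ i)]
  simp only [toLieAlgebra_apply]
  fin_cases i <;> simp <;> fun_prop

/-- Expand ξ in the frame and apply [fX, Y] = f[X, Y] - Y(f)X to each term. -/
theorem toLieAlgebra_lieBracket_leftInvariant {ξ : Space → Space}
    (hξ : ContDiff ℝ (⊤ : ℕ∞) ξ) (u p : Space) (i : Fin 4) :
    toLieAlgebra p (VectorField.lieBracket ℝ ξ (leftInvariant u) p) i =
      lieAlgebraBracket (fun k => component ξ k p) u i
        - fderiv ℝ (component ξ i) p (leftInvariant u p) := by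
  have hf (k : Fin 4) : DifferentiableAt ℝ (component ξ k) p :=
    (contDiff_component hξ k).differentiable (by simp) p
  have hX (k : Fin 4) : DifferentiableAt ℝ (frame k) p := differentiable_leftInvariant _ p
  have hfX (k : Fin 4) : DifferentiableAt ℝ (fun q => component ξ k q • frame k q) p :=
    (hf k).smul (hX k)
  have hsum : ξ = (fun q => component ξ 0 q • frame 0 q) + (fun q => component ξ 1 q • frame 1 q)
      + (fun q => component ξ 2 q • frame 2 q) + (fun q => component ξ 3 q • frame 3 q) := by
    funext q
    simpa [Fin.sum_univ_four] using eq_sum_component ξ q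
  have hb : VectorField.lieBracket ℝ ξ (leftInvariant u) p =
      ∑ k, (-(fderiv ℝ (component ξ k) p (leftInvariant u p)) • frame k p
        + component ξ k p • leftInvariant (lieAlgebraBracket (Pi.single k 1) u) p) := by
    conv_lhs => rw [hsum]
    rw [VectorField.lieBracket_add_left (((hfX 0).add (hfX 1)).add (hfX 2)) (hfX 3),
      VectorField.lieBracket_add_left ((hfX 0).add (hfX 1)) (hfX 2),
      VectorField.lieBracket_add_left (hfX 0) (hfX 1), Fin.sum_univ_four]
    simp only [VectorField.lieBracket_smul_left (hf _) (hX _)]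
    simp only [frame, lieBracket_leftInvariant]
  rw [hb]
  simp only [map_add, map_smul, frame, toLieAlgebra_leftInvariant, Fin.sum_univ_four,
    Pi.add_apply, Pi.smul_apply, smul_eq_mul, Pi.single_apply]
  fin_cases i <;> simp [lieAlgebraBracket, bracketZ] <;> ring

/-- Left-invariant fields have constant inner products, so only the two bracket terms survive. -/
theorem lieDerivMetric_leftInvariant {ξ : Space → Space} (hξ : ContDiff ℝ (⊤ : ℕ∞) ξ)
    (u w p : Space) :
    lieDerivMetric ξ (leftInvariant u) (leftInvariant w) p =
      ∑ i, ((fderiv ℝ (component ξ i) p (leftInvariant u p)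
          - lieAlgebraBracket (fun k => component ξ k p) u i) * w i
        + u i * (fderiv ℝ (component ξ i) p (leftInvariant w p)
          - lieAlgebraBracket (fun k => component ξ k p) w i)) := by
  simp only [lieDerivMetric, metric_leftInvariant]
  simp only [metric, toLieAlgebra_leftInvariant, toLieAlgebra_lieBracket_leftInvariant hξ,
    fderiv_fun_const, Pi.zero_apply, zero_apply, Fin.sum_univ_four]
  ring

/-! ### Elimination and vanishing of the potential -/

/-- A purely linear consequence of the conformal Killing equations in the left-invariant frame:
`D i` is the derivative along the `i`-th frame field and `f i` the `i`-th component. The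
combination of the equations is the linearized Weyl tensor. -/
theorem eq_zero_of_conformal_system {M : Type*} [AddCommGroup M] [Module ℝ M]
    (D : Fin 4 → M →ₗ[ℝ] M) (f : Fin 4 → M)
    (h10 : ∀ g, D 1 (D 0 g) = D 0 (D 1 g) - D 2 g)
    (h20 : ∀ g, D 2 (D 0 g) = D 0 (D 2 g))
    (h21 : ∀ g, D 2 (D 1 g) = D 1 (D 2 g))
    (h30 : ∀ g, D 3 (D 0 g) = D 0 (D 3 g) + (1 / 2 : ℝ) • D 0 g)
    (h31 : ∀ g, D 3 (D 1 g) = D 1 (D 3 g) + (1 / 2 : ℝ) • D 1 g)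
    (h32 : ∀ g, D 3 (D 2 g) = D 2 (D 3 g) + D 2 g)
    (e00 : D 0 (f 0) - (1 / 2 : ℝ) • f 3 - D 3 (f 3) = 0)
    (e11 : D 1 (f 1) - (1 / 2 : ℝ) • f 3 - D 3 (f 3) = 0)
    (e22 : D 2 (f 2) - f 3 - D 3 (f 3) = 0)
    (e01 : D 0 (f 1) + D 1 (f 0) = 0)
    (e02 : D 0 (f 2) + D 2 (f 0) + f 1 = 0)
    (e12 : D 1 (f 2) + D 2 (f 1) - f 0 = 0)
    (e13 : D 1 (f 3) + D 3 (f 1) + (1 / 2 : ℝ) • f 1 = 0)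
    (e23 : D 2 (f 3) + D 3 (f 2) + f 2 = 0) :
    D 3 (f 3) = 0 := by
  -- The four second-order terms are those of the linearized curvature component with index pairs
  -- (0, 3) and (1, 2). Its indices are distinct, so no trace terms enter the Weyl tensor; the rest
  -- are lower-order corrections from the brackets.
  have d3e22 := congrArg (D 3) e22
  have d13e02 := congrArg (fun g => D 1 (D 3 g)) e02
  have d02e13 := congrArg (fun g => D 0 (D 2 g)) e13
  have d01e23 := congrArg (fun g => D 0 (D 1 g)) e23
  have d23e01 := congrArg (fun g => D 2 (D 3 g)) e01
  have d3e11 := congrArg (D 3) e11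
  have d0e12 := congrArg (D 0) e12
  have d2e01 := congrArg (D 2) e01
  simp only [map_add, map_sub, map_smul, map_zero, h10, h20, h21, h30, h31, h32]
    at d3e22 d13e02 d02e13 d01e23 d23e01 d3e11 d0e12 d2e01
  linear_combination (norm := module) (-(1 / 2) : ℝ) • e00 + (1 / 2 : ℝ) • e22 - d3e22 - d13e02 - d02e13
    + d01e23 + d23e01 + d3e11 - (1 / 2 : ℝ) • e11 - (1 / 2 : ℝ) • d0e12 + (1 / 2 : ℝ) • d2e01

/-- The potential of a conformal vector field vanishes, and it is the derivative of the
`A`-component along `A`. -/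
theorem IsConformalWithPotential.derivAlong_component {ξ : Space → Space} {ρ : Space → ℝ}
    (h : IsConformalWithPotential ξ ρ) (p : Space) :
    fderiv ℝ (component ξ 3) p (frame 3 p) = ρ p ∧ ρ p = 0 := by
  obtain ⟨hξ, -, hL⟩ := h
  let f (i : Fin 4) : smoothFunctions := ⟨component ξ i, contDiff_component hξ i⟩
  let D (i : Fin 4) : smoothFunctions →ₗ[ℝ] smoothFunctions := derivAlong (Pi.single i 1)
  have hE (i j : Fin 4) (q : Space) := hL (frame i) (frame j)
    (contDiff_leftInvariant _) (contDiff_leftInvariant _) q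
  simp only [frame, lieDerivMetric_leftInvariant hξ, metric_leftInvariant] at hE
  have hD (i j : Fin 4) (q : Space) :
      (D i (f j)).1 q = fderiv ℝ (component ξ j) q (leftInvariant (Pi.single i 1) q) := rfl
  -- Brackets have no A-component, so the (A, A) equation is just A f₄ = ρ.
  have hρ (q : Space) : (D 3 (f 3)).1 q = ρ q := by
    have := hE 3 3 q
    simp [Fin.sum_univ_four, lieAlgebraBracket, bracketZ] at this
    rw [hD]
    linarith
  have hf (j : Fin 4) (q : Space) : (f j).1 q = component ξ j q := rfl
  have hcomm (i j : Fin 4) (c : ℝ) (k : Fin 4) (g : smoothFunctions)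
      (hb : ∀ l, lieAlgebraBracket (Pi.single i 1) (Pi.single j 1) l =
        (c • Pi.single k 1 : Space) l) :
      D i (D j g) = D j (D i g) + c • D k g := by
    rw [derivAlong_comm, funext hb, derivAlong_smul]
  have hzero : D 3 (f 3) = 0 := by
    apply eq_zero_of_conformal_system D f
    case h10 =>
      intro g
      rw [hcomm 1 0 (-1) 2 g (by intro l; fin_cases l <;> simp [lieAlgebraBracket, bracketZ])]
      module
    case h20 =>
      intro g
      rw [hcomm 2 0 0 0 g (by intro l; fin_cases l <;> simp [lieAlgebraBracket, bracketZ])]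
      module
    case h21 =>
      intro g
      rw [hcomm 2 1 0 0 g (by intro l; fin_cases l <;> simp [lieAlgebraBracket, bracketZ])]
      module
    case h30 =>
      intro g
      rw [hcomm 3 0 (1 / 2) 0 g (by intro l; fin_cases l <;> simp [lieAlgebraBracket, bracketZ])]
    case h31 =>
      intro g
      rw [hcomm 3 1 (1 / 2) 1 g (by intro l; fin_cases l <;> simp [lieAlgebraBracket, bracketZ])]
    case h32 =>
      intro g
      rw [hcomm 3 2 1 2 g (by intro l; fin_cases l <;> simp [lieAlgebraBracket, bracketZ])]
      module
    all_goals
      ext q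
      have h0 := hE 0 0 q
      have h1 := hE 1 1 q
      have h2 := hE 2 2 q
      have h01 := hE 0 1 q
      have h02 := hE 0 2 q
      have h12 := hE 1 2 q
      have h13 := hE 1 3 q
      have h23 := hE 2 3 q
      simp [Fin.sum_univ_four, lieAlgebraBracket, bracketZ] at h0 h1 h2 h01 h02 h12 h13 h23
      simp [hρ, hf, hD]
      linarith
  refine ⟨hρ p, ?_⟩
  rw [← hρ p, hzero]
  rfl

end CH2

theorem mainTheorem2 (ξ : CH2.Space → CH2.Space) (ρ : CH2.Space → ℝ)
    (hξ : CH2.IsConformalWithPotential ξ ρ) :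
    (∀ (p : CH2.Space) (t : ℝ),
      CH2.component ξ 3 (Function.update p 3 t) = CH2.component ξ 3 p) ∧
    (∀ p : CH2.Space,
      HasDerivAt (fun t : ℝ => CH2.component ξ 3 (Function.update p 3 t)) (ρ p) (p 3)) ∧
    (∀ p : CH2.Space, ρ p = 0) ∧
    CH2.IsKilling ξ := by
  have hρ (p : CH2.Space) : ρ p = 0 := (hξ.derivAlong_component p).2
  have hderiv (p : CH2.Space) (s : ℝ) :
      HasDerivAt (fun t : ℝ => CH2.component ξ 3 (Function.update p 3 t))
        (ρ (Function.update p 3 s)) s := by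
    -- A is the coordinate field ∂_a, so differentiating along it means varying only the last
    -- coordinate.
    have hframe : CH2.frame 3 (Function.update p 3 s) = Pi.single 3 1 := by
      rw [(CH2.frame_eq _).2.2.2]
      ext i
      fin_cases i <;> simp
    rw [← (hξ.derivAlong_component _).1, hframe]
    exact ((CH2.contDiff_component hξ.1 3).differentiable (by simp)
      _).hasFDerivAt.comp_hasDerivAt s (hasDerivAt_update p 3 s)
  refine ⟨fun p t => ?_, fun p => ?_, hρ, hξ.1, fun X Y hX hY p => ?_⟩
  · have hconst := is_const_of_deriv_eq_zero (fun s => (hderiv p s).differentiableAt)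
      (fun s => (hderiv p s).deriv.trans (hρ _)) t (p 3)
    simpa using hconst
  · simpa using hderiv p (p 3)
  · rw [hξ.2.2 X Y hX hY p, hρ p]
    simp
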